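/- Let $K$ be a field of characteristic $0$. Then the group $\mathrm{PGL}_3(K)$ contains a subgroup isomorphic to $\mathrm{PSL}_2(\mathbb{F}_7)$ if and only if $\sqrt{-7}\in K$, that is, if and only if there is an element $x\in K$ with $x^2=-7$. -/

import Mathlib

/-! In `PSL₂(𝔽₇)` an element `u` of order 7 satisfies `d u d⁻¹ = u²` with `d³ = 1`. A lift `B` of
`u` to `GL₃(K)` can be scaled so that this holds exactly; then `B⁷ = 1`, `det B = 1`, and `B`, `B²`,
`B⁴` share a trace `t`. By Cayley–Hamilton `t² + t + 2 = 0` (`trace_cubic_of_trace_sq`), so `(2t +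
1)² = -7`. Conversely, Klein's matrices over `ℤ[ω]` satisfy the Bruhat relations, so
`exists_hom_of_bruhat` yields a representation of `SL₂(𝔽₇)`. It kills the centre, and simplicity of
`PSL₂(𝔽₇)` makes the induced projective map injective. -/

open Matrix

/-! ### Homomorphisms out of `SL₂(F)` from Bruhat relations -/

section Bruhat

variable {F M : Type*} [Field F] [Monoid M]

/-- The value on an element of `SL(2, F)` prescribed by its Bruhat decomposition. -/
noncomputable def bruhatFun (τ δ : F → M) (w : M) (g : SpecialLinearGroup (Fin 2) F) : M :=
  open Classical in
  if g 1 0 = 0 then τ (g 0 0 * g 0 1) * δ (g 0 0)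
  else τ (g 0 0 / g 1 0) * w * δ (g 1 0) * τ (g 1 1 / g 1 0)

/-- The upper unipotent element of `SL(2, F)`. -/
def slUnip (x : F) : SpecialLinearGroup (Fin 2) F := ⟨!![1, x; 0, 1], by simp⟩

/-- The Weyl element of `SL(2, F)`. -/
def slWeyl : SpecialLinearGroup (Fin 2) F := ⟨!![0, -1; 1, 0], by simp⟩

/-- The diagonal element of `SL(2, F)` attached to a nonzero scalar. -/
def slDiag (a : F) (ha : a ≠ 0) : SpecialLinearGroup (Fin 2) F := ⟨!![a, 0; 0, a⁻¹], by simp [ha]⟩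

theorem coe_slUnip (x : F) : (slUnip x : Matrix (Fin 2) (Fin 2) F) = !![1, x; 0, 1] := rfl

theorem coe_slWeyl : (slWeyl : SpecialLinearGroup (Fin 2) F).val = !![0, -1; 1, 0] := rfl

theorem coe_slDiag (a : F) (ha : a ≠ 0) :
    (slDiag a ha : Matrix (Fin 2) (Fin 2) F) = !![a, 0; 0, a⁻¹] := rfl

theorem sl_two_eq (g : SpecialLinearGroup (Fin 2) F) :
    g 0 0 * g 1 1 - g 0 1 * g 1 0 = 1 := by
  have := g.det_coe
  rwa [det_fin_two] at this

theorem sl_two_eq_of_lower_eq_zero (g : SpecialLinearGroup (Fin 2) F) (hc : g 1 0 = 0)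
    (ha : g 0 0 ≠ 0) : g = slUnip (g 0 0 * g 0 1) * slDiag (g 0 0) ha := by
  have h := sl_two_eq g
  rw [hc, mul_zero, sub_zero] at h
  ext i j
  fin_cases i <;> fin_cases j <;>
    simp [coe_slUnip, coe_slDiag, mul_apply, Fin.sum_univ_two, hc]
  · field_simp
  · exact eq_inv_of_mul_eq_one_right h

theorem sl_two_eq_of_lower_ne_zero (g : SpecialLinearGroup (Fin 2) F) (hc : g 1 0 ≠ 0) :
    g = slUnip (g 0 0 / g 1 0) * slWeyl * slDiag (g 1 0) hc * slUnip (g 1 1 / g 1 0) := by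
  have h := sl_two_eq g
  ext i j
  fin_cases i <;> fin_cases j <;>
    simp [coe_slUnip, coe_slDiag, coe_slWeyl, mul_apply, Fin.sum_univ_two] <;> field_simp
  linear_combination -h

/-- Bruhat normal forms are unique, and the relations suffice to bring any product back to normal
form. -/
theorem exists_hom_of_bruhat (τ δ : F → M) (w : M)
    (hτ0 : τ 0 = 1) (hτ : ∀ x y, τ (x + y) = τ x * τ y)
    (hδ1 : δ 1 = 1) (hδ : ∀ a b, a ≠ 0 → b ≠ 0 → δ (a * b) = δ a * δ b)
    (hδτ : ∀ a x, a ≠ 0 → δ a * τ x = τ (a ^ 2 * x) * δ a)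
    (hwδ : ∀ a, a ≠ 0 → w * δ a = δ a⁻¹ * w)
    (hww : w * w = δ (-1))
    (hwτ : ∀ y, y ≠ 0 → w * τ y * w = τ (-y⁻¹) * w * δ y * τ (-y⁻¹)) :
    ∃ Φ : SpecialLinearGroup (Fin 2) F →* M, (∀ x, Φ (slUnip x) = τ x) ∧ Φ slWeyl = w := by
  have hb0 : ∀ g : SpecialLinearGroup (Fin 2) F, g 1 0 = 0 →
      bruhatFun τ δ w g = τ (g 0 0 * g 0 1) * δ (g 0 0) := fun g h ↦ if_pos h
  have hb1 : ∀ g : SpecialLinearGroup (Fin 2) F, g 1 0 ≠ 0 →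
      bruhatFun τ δ w g = τ (g 0 0 / g 1 0) * w * δ (g 1 0) * τ (g 1 1 / g 1 0) :=
    fun g h ↦ if_neg h
  have ha0 : ∀ g : SpecialLinearGroup (Fin 2) F, g 1 0 = 0 → g 0 0 ≠ 0 := by
    intro g hc ha
    have := sl_two_eq g
    simp [hc, ha] at this
  have hU : ∀ x, bruhatFun τ δ w (slUnip x) = τ x := fun x ↦ by
    rw [hb0 _ (by simp [coe_slUnip])]; simp [coe_slUnip, hδ1]
  have hW : bruhatFun τ δ w slWeyl = w := by
    rw [hb1 _ (by simp [coe_slWeyl])]; simp [coe_slWeyl, hδ1, hτ0]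
  have hD : ∀ a ha, bruhatFun τ δ w (slDiag a ha) = δ a := fun a ha ↦ by
    rw [hb0 _ (by simp [coe_slDiag])]; simp [coe_slDiag, hτ0]
  -- The right factors respected by the map form a submonoid, so only generators need checking.
  let S : Submonoid (SpecialLinearGroup (Fin 2) F) :=
    { carrier := {h | ∀ g, bruhatFun τ δ w (g * h) = bruhatFun τ δ w g * bruhatFun τ δ w h}
      one_mem' := fun g ↦ by
        have h1 : bruhatFun τ δ w 1 = 1 := by
          rw [hb0 _ (by simp)]; simp [hδ1, hτ0]
        rw [h1, mul_one, mul_one]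
      mul_mem' := fun {h k} hh hk g ↦ by
        rw [← mul_assoc, hk, hh, hk, mul_assoc] }
  have hUS : ∀ x, slUnip x ∈ S := by
    intro x g
    rw [hU]
    have e00 : (g * slUnip x) 0 0 = g 0 0 := by simp [coe_slUnip, mul_apply, Fin.sum_univ_two]
    have e01 : (g * slUnip x) 0 1 = g 0 0 * x + g 0 1 := by
      simp [coe_slUnip, mul_apply, Fin.sum_univ_two]
    have e10 : (g * slUnip x) 1 0 = g 1 0 := by simp [coe_slUnip, mul_apply, Fin.sum_univ_two]
    have e11 : (g * slUnip x) 1 1 = g 1 0 * x + g 1 1 := by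
      simp [coe_slUnip, mul_apply, Fin.sum_univ_two]
    by_cases hc : g 1 0 = 0
    · rw [hb0 _ (e10.trans hc), hb0 _ hc, e00, e01, mul_assoc, hδτ _ _ (ha0 g hc), ← mul_assoc,
        ← hτ]
      congr 2
      ring
    · rw [hb1 _ (by rwa [e10]), hb1 _ hc, e00, e10, e11, mul_assoc _ (τ _) (τ x), ← hτ]
      congr 2
      field_simp
      ring
  have hDS : ∀ a ha, slDiag a ha ∈ S := by
    intro a ha g
    rw [hD]
    have e00 : (g * slDiag a ha) 0 0 = g 0 0 * a := by
      simp [coe_slDiag, mul_apply, Fin.sum_univ_two]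
    have e01 : (g * slDiag a ha) 0 1 = g 0 1 * a⁻¹ := by
      simp [coe_slDiag, mul_apply, Fin.sum_univ_two]
    have e10 : (g * slDiag a ha) 1 0 = g 1 0 * a := by
      simp [coe_slDiag, mul_apply, Fin.sum_univ_two]
    have e11 : (g * slDiag a ha) 1 1 = g 1 1 * a⁻¹ := by
      simp [coe_slDiag, mul_apply, Fin.sum_univ_two]
    by_cases hc : g 1 0 = 0
    · rw [hb0 _ (by simp [e10, hc]), hb0 _ hc, e00, e01, hδ _ _ (ha0 g hc) ha, ← mul_assoc]
      congr 3
      field_simp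
    · have key : τ (g 1 1 / g 1 0) * δ a = δ a * τ (g 1 1 * a⁻¹ / (g 1 0 * a)) := by
        rw [hδτ _ _ ha]
        congr 2
        field_simp
      rw [hb1 _ (by rw [e10]; exact mul_ne_zero hc ha), hb1 _ hc, e00, e10, e11, hδ _ _ hc ha,
        mul_assoc _ (τ _) (δ a), key, mul_div_mul_right _ _ ha]
      simp only [mul_assoc]
  have hWS : slWeyl ∈ S := by
    intro g
    rw [hW]
    have hdet := sl_two_eq g
    have e00 : (g * (slWeyl : SpecialLinearGroup (Fin 2) F)) 0 0 = g 0 1 := by simp [coe_slWeyl, mul_apply, Fin.sum_univ_two]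
    have e01 : (g * (slWeyl : SpecialLinearGroup (Fin 2) F)) 0 1 = -g 0 0 := by simp [coe_slWeyl, mul_apply, Fin.sum_univ_two]
    have e10 : (g * (slWeyl : SpecialLinearGroup (Fin 2) F)) 1 0 = g 1 1 := by simp [coe_slWeyl, mul_apply, Fin.sum_univ_two]
    have e11 : (g * (slWeyl : SpecialLinearGroup (Fin 2) F)) 1 1 = -g 1 0 := by simp [coe_slWeyl, mul_apply, Fin.sum_univ_two]
    by_cases hc : g 1 0 = 0
    · have ha := ha0 g hc
      rw [hc, mul_zero, sub_zero] at hdet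
      have hd : g 1 1 = (g 0 0)⁻¹ := eq_inv_of_mul_eq_one_right hdet
      have hd0 : g 1 1 ≠ 0 := by rw [hd]; exact inv_ne_zero ha
      rw [hb1 _ (by rwa [e10]), hb0 _ hc, e00, e10, e11, hc, neg_zero, zero_div, hτ0, mul_one,
        mul_assoc, hwδ _ hd0, hd, inv_inv, ← mul_assoc, div_inv_eq_mul, mul_comm (g 0 1)]
    · by_cases hd : g 1 1 = 0
      · rw [hd, mul_zero, zero_sub] at hdet
        have hb : g 0 1 = (g 1 0)⁻¹ * (-1) := by
          field_simp
          linear_combination -hdet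
        rw [hb0 _ (by rw [e10, hd]), hb1 _ hc, e00, e01, hd, zero_div, hτ0, mul_one, mul_assoc (τ _),
          hwδ _ hc, mul_assoc (τ _), mul_assoc (δ _), hww, ← hδ _ _ (inv_ne_zero hc) (by simp), hb]
        congr 2
        field_simp
      -- The generic case, the only one needing `hwτ`.
      · have hcd : g 1 1 / g 1 0 ≠ 0 := div_ne_zero hd hc
        have hb : g 0 1 / g 1 1 = g 0 0 / g 1 0 + ((g 1 0)⁻¹) ^ 2 * -(g 1 1 / g 1 0)⁻¹ := by
          field_simp
          linear_combination -hdet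
        rw [hb1 _ (by rwa [e10]), hb1 _ hc, e00, e10, e11]
        calc _ = τ (g 0 0 / g 1 0) * (τ (((g 1 0)⁻¹) ^ 2 * -(g 1 1 / g 1 0)⁻¹) *
              (w * (δ (g 1 0) * δ (g 1 1 / g 1 0)))) * τ (-(g 1 1 / g 1 0)⁻¹) := by
              rw [hb, hτ, ← hδ _ _ hc hcd, mul_div_cancel₀ _ hc, inv_div, neg_div]
              simp only [mul_assoc]
          _ = τ (g 0 0 / g 1 0) * (δ (g 1 0)⁻¹ * (w * τ (g 1 1 / g 1 0) * w)) := by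
              rw [hwτ _ hcd, ← mul_assoc w, hwδ _ hc]
              simp only [← mul_assoc]
              rw [mul_assoc _ (δ (g 1 0)⁻¹) (τ _), hδτ _ _ (inv_ne_zero hc)]
              simp only [← mul_assoc]
          _ = _ := by
              simp only [← mul_assoc]
              rw [mul_assoc (τ _), ← hwδ _ hc]
              simp only [← mul_assoc]
  have hS : ∀ h, h ∈ S := by
    intro h
    by_cases hc : h 1 0 = 0
    · rw [sl_two_eq_of_lower_eq_zero h hc (ha0 h hc)]
      exact mul_mem (hUS _) (hDS _ _)
    · rw [sl_two_eq_of_lower_ne_zero h hc]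
      exact mul_mem (mul_mem (mul_mem (hUS _) hWS) (hDS _ _)) (hUS _)
  refine ⟨⟨⟨bruhatFun τ δ w, ?_⟩, fun g h ↦ hS h g⟩, hU, hW⟩
  rw [hb0 _ (by simp)]
  simp [hδ1, hτ0]

end Bruhat

/-! ### The trace of an element of order 7 -/

theorem trace_cubic_of_trace_sq {K : Type*} [Field K] [CharZero K] (A : Matrix (Fin 3) (Fin 3) K)
    (hdet : A.det = 1) (h2 : (A ^ 2).trace = A.trace) (h4 : (A ^ 4).trace = A.trace)
    (h7 : A ^ 7 = 1) (hA : A ≠ 1) : A.trace ^ 2 + A.trace + 2 = 0 := by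
  -- Cayley–Hamilton, with `s` the sum of the principal 2×2 minors.
  obtain ⟨s, hs⟩ : ∃ s, A ^ 3 = A.trace • A ^ 2 - s • A + A.det • 1 ∧
      (A ^ 2).trace = A.trace ^ 2 - 2 * s := by
    refine ⟨A 0 0 * A 1 1 - A 0 1 * A 1 0 + A 0 0 * A 2 2 - A 0 2 * A 2 0 + A 1 1 * A 2 2
      - A 1 2 * A 2 1, ?_, ?_⟩
    · ext i j
      fin_cases i <;> fin_cases j <;>
        simp [pow_succ, mul_apply, Fin.sum_univ_three, det_fin_three, trace_fin_three] <;> ring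
    · simp [pow_succ, mul_apply, Fin.sum_univ_three, trace_fin_three]
      ring
  obtain ⟨hch, hs2⟩ := hs
  rw [hdet, one_smul] at hch
  set t := A.trace with ht
  have p3 : (A ^ 3).trace = t * (A ^ 2).trace - s * t + 3 := by
    rw [hch]
    simp [ht]
  have hch4 : A ^ 4 = t • A ^ 3 - s • A ^ 2 + A := by
    calc A ^ 4 = A ^ 3 * A := pow_succ A 3
      _ = _ := by
        rw [hch, add_mul, sub_mul, smul_mul_assoc, smul_mul_assoc, one_mul, ← pow_succ, ← sq, ← hch]
  have p4 : (A ^ 4).trace = t * (A ^ 3).trace - s * (A ^ 2).trace + t := by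
    rw [hch4]
    simp [ht]
  rw [h2] at hs2 p3 p4
  rw [h4, p3] at p4
  have hs' : s = (t ^ 2 - t) / 2 := by linear_combination (1 / 2 : K) * hs2
  have hprod : t * ((t - 3) * (t ^ 2 + t + 2)) = 0 := by
    rw [hs'] at p4
    linear_combination 2 * p4
  rcases mul_eq_zero.mp hprod with h0 | h
  · exfalso
    rw [h0] at hs'
    have h3 : A ^ 3 = 1 := by
      rw [hch, h0, hs']; simp
    apply hA
    calc A = A ^ 7 := by rw [show 7 = 3 * 2 + 1 from rfl, pow_succ, pow_mul, h3]; simp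
      _ = 1 := h7
  rcases mul_eq_zero.mp h with h3 | h
  · exfalso
    have h3 : t = 3 := sub_eq_zero.mp h3
    rw [h3] at hs' hch
    have hs3 : s = 3 := by rw [hs']; norm_num
    rw [hs3] at hch
    have smul3 : ∀ X : Matrix (Fin 3) (Fin 3) K, (3 : K) • X = 3 • X := fun X ↦ by
      rw [← Nat.cast_smul_eq_nsmul K, Nat.cast_ofNat]
    have eq_zero : ∀ (n : ℕ) (X : Matrix (Fin 3) (Fin 3) K), n ≠ 0 → n • X = 0 → X = 0 := by
      intro n X hn hX
      rw [← Nat.cast_smul_eq_nsmul K] at hX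
      exact (smul_eq_zero.mp hX).resolve_left (Nat.cast_ne_zero.mpr hn)
    rw [smul3, smul3] at hch
    -- Here the characteristic polynomial is `(X - 1)³`; a unipotent matrix of finite order in
    -- characteristic 0 is trivial.
    obtain ⟨N, rfl⟩ : ∃ N, A = 1 + N := ⟨A - 1, by abel⟩
    have e3 : N ^ 3 = 0 := by
      have : (1 + N) ^ 3 - (3 • (1 + N) ^ 2 - 3 • (1 + N) + 1) = N ^ 3 := by noncomm_ring
      rw [← this, ← hch, sub_self]
    have e7 : (1 + N) ^ 7 = 1 + 7 • N + 21 • N ^ 2 +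
        N ^ 3 * (35 • 1 + 35 • N + 21 • N ^ 2 + 7 • N ^ 3 + N ^ 4) := by
      noncomm_ring
    rw [h7, e3, zero_mul, add_zero, add_assoc, left_eq_add] at e7
    have e2 : N ^ 2 = 0 := by
      have : N * (7 • N + 21 • N ^ 2) = 7 • N ^ 2 + 21 • N ^ 3 := by noncomm_ring
      rw [e7, e3, mul_zero, smul_zero, add_zero] at this
      exact eq_zero 7 _ (by norm_num) this.symm
    rw [e2, smul_zero, add_zero] at e7
    exact hA (by rw [eq_zero 7 _ (by norm_num) e7, add_zero])
  · exact h

/-! ### Klein's representation -/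

/-- The ring of integers `ℤ[ω]` of `ℚ(√-7)`, where `ω² + ω + 2 = 0`. -/
abbrev KleinRing := QuadraticAlgebra ℤ (-2) (-1)

/-- The image of the upper unipotent element in Klein's three-dimensional representation of `PSL₂(𝔽₇)`. -/
def kleinT : Matrix (Fin 3) (Fin 3) KleinRing :=
  !![⟨1, 0⟩, ⟨0, 0⟩, ⟨-1, -2⟩; ⟨-1, 0⟩, ⟨0, 0⟩, ⟨0, 2⟩; ⟨0, 0⟩, ⟨1, 0⟩, ⟨-1, 1⟩]

/-- The image of `diag(4, 2)` in Klein's representation. -/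
def kleinD : Matrix (Fin 3) (Fin 3) KleinRing :=
  !![⟨1, 1⟩, ⟨0, 0⟩, ⟨4, 1⟩; ⟨0, -1⟩, ⟨0, 0⟩, ⟨-3, -2⟩; ⟨1, 0⟩, ⟨1, 0⟩, ⟨-1, -1⟩]

/-- The image of the Weyl element in Klein's representation. -/
def kleinW : Matrix (Fin 3) (Fin 3) KleinRing :=
  !![⟨-1, 0⟩, ⟨2, 1⟩, ⟨-4, 0⟩; ⟨0, 0⟩, ⟨-2, -1⟩, ⟨3, 1⟩; ⟨0, 0⟩, ⟨-1, -1⟩, ⟨2, 1⟩]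

theorem kleinT_pow : kleinT ^ 7 = 1 := by decide +kernel

theorem kleinD_pow : kleinD ^ 3 = 1 := by decide +kernel

theorem kleinW_mul_self : kleinW * kleinW = 1 := by decide +kernel

theorem kleinD_mul_kleinT : kleinD * kleinT = kleinT ^ 2 * kleinD := by decide +kernel

theorem kleinW_mul_kleinD : kleinW * kleinD = kleinD ^ 2 * kleinW := by decide +kernel

/-- Exponents of `kleinD` on the torus: `diag(a, a⁻¹) = ± diag(4, 2) ^ kleinExp a` for `a ≠ 0`. -/
def kleinExp : ZMod 7 → ℕ := ![0, 0, 2, 1, 1, 2, 0]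

/-- This is the relation `hwτ` of `exists_hom_of_bruhat`, with `y⁻¹` written as `y ^ 5`. -/
theorem kleinW_mul_kleinT_pow_mul_kleinW : ∀ y : ZMod 7, y ≠ 0 →
    kleinW * kleinT ^ y.val * kleinW = kleinT ^ (-y ^ 5).val * kleinW *
      kleinD ^ kleinExp y * kleinT ^ (-y ^ 5).val := by decide +kernel

instance fact_prime_seven : Fact (Nat.Prime 7) := ⟨by norm_num⟩

theorem exists_hom_of_klein_relations {M : Type*} [Monoid M] {t d w : M} (ht : t ^ 7 = 1)
    (hd : d ^ 3 = 1) (hw : w * w = 1) (hdt : d * t = t ^ 2 * d) (hwd : w * d = d ^ 2 * w)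
    (hwt : ∀ y : ZMod 7, y ≠ 0 →
      w * t ^ y.val * w = t ^ (-y ^ 5).val * w * d ^ kleinExp y * t ^ (-y ^ 5).val) :
    ∃ Φ : SpecialLinearGroup (Fin 2) (ZMod 7) →* M, Φ (slUnip 1) = t ∧ Φ slWeyl = w := by
  have hTmod : ∀ n, t ^ (n % 7) = t ^ n := fun n ↦ (pow_eq_pow_mod n ht).symm
  have hDmod : ∀ n, d ^ (n % 3) = d ^ n := fun n ↦ (pow_eq_pow_mod n hd).symm
  have hinv : ∀ y : ZMod 7, y⁻¹ = y ^ 5 := by decide +kernel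
  have hDT : ∀ k n, d ^ k * t ^ n = t ^ (2 ^ k * n) * d ^ k := by
    have h1 : ∀ n, d * t ^ n = t ^ (2 * n) * d := by
      intro n
      induction n with
      | zero => simp
      | succ n ih =>
        rw [pow_succ, ← mul_assoc, ih, mul_assoc, hdt, ← mul_assoc, ← pow_add,
          mul_add_one]
    intro k n
    induction k generalizing n with
    | zero => simp
    | succ k ih =>
      rw [pow_succ, mul_assoc, h1, ← mul_assoc, ih, mul_assoc, ← mul_assoc (2 ^ k), ← pow_succ]
  have hWD : ∀ k, w * d ^ k = d ^ (2 * k) * w := by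
    intro k
    induction k with
    | zero => simp
    | succ k ih =>
      rw [pow_succ, ← mul_assoc, ih, mul_assoc, hwd, ← mul_assoc, ← pow_add,
        mul_add_one]
  obtain ⟨Φ, hΦ, hΦw⟩ := exists_hom_of_bruhat (F := ZMod 7) (fun y ↦ t ^ y.val)
    (fun a ↦ d ^ kleinExp a) w (by simp)
    (fun x y ↦ by rw [ZMod.val_add, hTmod, pow_add])
    (by simp [show kleinExp 1 = 0 from rfl])
    (fun a b ha hb ↦ by
      have : ∀ a b : ZMod 7, a ≠ 0 → b ≠ 0 →
        kleinExp (a * b) = (kleinExp a + kleinExp b) % 3 := by decide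
      rw [this a b ha hb, hDmod, pow_add])
    (fun a x ha ↦ by
      have : ∀ a x : ZMod 7, a ≠ 0 → (a ^ 2 * x).val = (2 ^ kleinExp a * x.val) % 7 := by decide
      rw [hDT, this a x ha, hTmod])
    (fun a ha ↦ by
      have : ∀ a : ZMod 7, a ≠ 0 → kleinExp (a ^ 5) = (2 * kleinExp a) % 3 := by decide
      rw [hWD, hinv, this a ha, hDmod])
    (by rw [hw, show kleinExp (-1) = 0 from rfl, pow_zero])
    (fun y hy ↦ by rw [hinv]; exact hwt y hy)
  refine ⟨Φ, ?_, hΦw⟩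
  rw [hΦ, show (1 : ZMod 7).val = 1 from rfl, pow_one]

theorem exists_klein_hom : ∃ Φ : SpecialLinearGroup (Fin 2) (ZMod 7) →*
    Matrix (Fin 3) (Fin 3) KleinRing, Φ (slUnip 1) = kleinT ∧ Φ slWeyl = kleinW :=
  exists_hom_of_klein_relations kleinT_pow kleinD_pow kleinW_mul_self kleinD_mul_kleinT
    kleinW_mul_kleinD kleinW_mul_kleinT_pow_mul_kleinW

theorem eq_one_or_eq_slWeyl_sq {F : Type*} [Field F] {z : SpecialLinearGroup (Fin 2) F}
    (hz : z ∈ Subgroup.center (SpecialLinearGroup (Fin 2) F)) : z = 1 ∨ z = slWeyl ^ 2 := by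
  obtain ⟨r, hr, hz⟩ := Matrix.SpecialLinearGroup.mem_center_iff.mp hz
  rcases (by simpa using hr : r = 1 ∨ r = -1) with rfl | rfl
  · exact Or.inl (Subtype.ext (by rw [← hz]; simp))
  · refine Or.inr (Matrix.SpecialLinearGroup.ext _ _ fun i j ↦ ?_)
    rw [← hz, sq]
    fin_cases i <;> fin_cases j <;> simp [coe_slWeyl, mul_apply, Fin.sum_univ_two]

theorem exists_injective_psl_hom {K : Type*} [Field K] [CharZero K] {x : K} (hx : x ^ 2 = -7) :
    ∃ Ψ : ProjectiveSpecialLinearGroup (Fin 2) (ZMod 7) →* ProjGenLinGroup (Fin 3) K,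
      Function.Injective Ψ := by
  obtain ⟨Φ, hΦ, hΦw⟩ := exists_klein_hom
  let ι : KleinRing →+* K := (QuadraticAlgebra.lift (a := (-2 : ℤ)) (b := -1)
    ⟨(x - 1) / 2, by simp; linear_combination hx / 4⟩).toRingHom
  let Θ : SpecialLinearGroup (Fin 2) (ZMod 7) →* ProjGenLinGroup (Fin 3) K :=
    ProjGenLinGroup.mk.comp ((GeneralLinearGroup.map ι).comp Φ.toHomUnits)
  -- `kleinT` has a nonzero off-diagonal entry, so its image is not scalar.
  have hΘ : Θ (slUnip 1) ≠ 1 := by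
    intro h
    have h := ProjGenLinGroup.mk_eq_one.mp h
    obtain ⟨c, hc⟩ := GeneralLinearGroup.mem_center_iff_val_mem_range_scalar.mp h
    have h10 := congrFun (congrFun hc 1) 0
    have e : ((GeneralLinearGroup.map ι).comp Φ.toHomUnits (slUnip 1)).val 1 0 =
        ι (Φ (slUnip 1) 1 0) := rfl
    rw [e, hΦ, show kleinT 1 0 = -1 from rfl, map_neg, map_one] at h10
    simp at h10
  have hker : Subgroup.center (SpecialLinearGroup (Fin 2) (ZMod 7)) ≤ Θ.ker := by
    intro z hz
    have h1 : Φ.toHomUnits z = 1 := by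
      refine Units.ext ?_
      rcases eq_one_or_eq_slWeyl_sq hz with rfl | rfl
      · simp
      · rw [MonoidHom.coe_toHomUnits, map_pow, hΦw, sq, kleinW_mul_self, Units.val_one]
    rw [MonoidHom.mem_ker, MonoidHom.comp_apply, MonoidHom.comp_apply, h1, map_one, map_one]
  let Ψ : ProjectiveSpecialLinearGroup (Fin 2) (ZMod 7) →* ProjGenLinGroup (Fin 3) K :=
    QuotientGroup.lift _ Θ hker
  refine ⟨Ψ, ?_⟩
  have hs : IsSimpleGroup (ProjectiveSpecialLinearGroup (Fin 2) (ZMod 7)) :=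
    ProjectiveSpecialLinearGroup.rank_two_simple (by simp)
  rcases hs.eq_bot_or_eq_top_of_normal Ψ.ker inferInstance with h | h
  · exact (MonoidHom.ker_eq_bot_iff Ψ).mp h
  · have hmem : (QuotientGroup.mk (slUnip 1) :
        ProjectiveSpecialLinearGroup (Fin 2) (ZMod 7)) ∈ Ψ.ker := h ▸ Subgroup.mem_top _
    exact absurd (MonoidHom.mem_ker.mp hmem) hΘ

/-! ### Lifting the relations from `PGL₃(K)` to `GL₃(K)` -/

theorem trace_eq_of_conj_eq_sq {K : Type*} [Field K] {B D : GL (Fin 3) K}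
    (h : D * B * D⁻¹ = B ^ 2) : (B.val ^ 2).trace = B.val.trace := by
  have := congrArg (fun X : GL (Fin 3) K ↦ X.val.trace) h
  simp only [Units.val_mul, Units.val_pow_eq_pow_val] at this
  rw [← this, trace_mul_comm, ← mul_assoc, ← Units.val_mul, inv_mul_cancel, Units.val_one, one_mul]

theorem exists_sq_eq_neg_seven {K : Type*} [Field K] [CharZero K] {u d : ProjGenLinGroup (Fin 3) K}
    (hd : d ^ 3 = 1) (hdu : d * u * d⁻¹ = u ^ 2) (hu : u ≠ 1) : ∃ x : K, x ^ 2 = -7 := by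
  obtain ⟨A, rfl⟩ := ProjGenLinGroup.mk_surjective u
  obtain ⟨D, rfl⟩ := ProjGenLinGroup.mk_surjective d
  rw [← map_inv, ← map_mul, ← map_mul, ← map_pow] at hdu
  obtain ⟨c, hc⟩ := ProjGenLinGroup.mk_eq_mk_iff.mp hdu
  have hs : ∀ (v : Kˣ) (X : GL (Fin 3) K), .scalar (Fin 3) v * X = X * .scalar (Fin 3) v :=
    GeneralLinearGroup.scalar_commute
  obtain ⟨B, hB, hBu⟩ : ∃ B : GL (Fin 3) K, D * B * D⁻¹ = B ^ 2 ∧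
      ProjGenLinGroup.mk B = ProjGenLinGroup.mk A := by
    refine ⟨A * .scalar _ c⁻¹, ?_, by simp⟩
    have hcs : GeneralLinearGroup.scalar (Fin 3) c * .scalar (Fin 3) c⁻¹ = 1 := by
      rw [← map_mul, mul_inv_cancel, map_one]
    calc D * (A * .scalar (Fin 3) c⁻¹) * D⁻¹ = D * A * (.scalar (Fin 3) c⁻¹ * D⁻¹) := by
          simp only [mul_assoc]
      _ = D * A * D⁻¹ * (.scalar (Fin 3) c * .scalar (Fin 3) c⁻¹) * .scalar (Fin 3) c⁻¹ := by
          rw [hs, hcs, mul_one, mul_assoc _ D⁻¹]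
      _ = A ^ 2 * .scalar (Fin 3) c⁻¹ ^ 2 := by rw [← mul_assoc, hc, mul_assoc, ← sq]
      _ = (A * .scalar (Fin 3) c⁻¹) ^ 2 := (Commute.mul_pow (hs _ A).symm 2).symm
  rw [← hBu] at hu
  have hpow : ∀ n, D * B ^ n * D⁻¹ = B ^ (2 * n) := fun n ↦ by rw [← conj_pow, hB, pow_mul]
  -- `D³` is scalar, while conjugating by `D` three times raises `B` to the power 8.
  have hB8 : B ^ 8 = B := by
    have hD3 : D ^ 3 * B = B * D ^ 3 :=
      (Subgroup.mem_center_iff.mp (ProjGenLinGroup.mk_eq_one.mp ((map_pow _ _ _).trans hd)) B).symm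
    calc B ^ 8 = D * (D * (D * B * D⁻¹) * D⁻¹) * D⁻¹ := by rw [hB, hpow, hpow]
      _ = D ^ 3 * B * (D ^ 3)⁻¹ := by simp only [pow_succ, pow_zero, one_mul, _root_.mul_inv_rev, mul_assoc]
      _ = B := by rw [hD3, mul_inv_cancel_right]
  have hB7 : B ^ 7 = 1 := by
    rw [pow_succ] at hB8
    exact mul_eq_right.mp hB8
  have hdet : B.val.det = 1 := by
    have := congrArg (fun X ↦ (GeneralLinearGroup.det X)) hB
    simp only [map_mul, map_inv, mul_inv_cancel_comm, sq] at this
    exact congrArg Units.val (left_eq_mul.mp this)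
  have h2 := trace_eq_of_conj_eq_sq hB
  have h4 := trace_eq_of_conj_eq_sq (B := B ^ 2) (D := D) (by rw [hpow, ← pow_mul])
  rw [Units.val_pow_eq_pow_val, ← pow_mul, h2] at h4
  have hne : B.val ≠ 1 := fun h ↦ hu (by rw [show B = 1 from Units.ext h, map_one])
  have key := trace_cubic_of_trace_sq B.val hdet h2 h4
    (by rw [← Units.val_pow_eq_pow_val, hB7, Units.val_one]) hne
  exact ⟨2 * B.val.trace + 1, by linear_combination 4 * key⟩

theorem four_ne_zero_zmod_seven : (4 : ZMod 7) ≠ 0 := by decide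

theorem proposition5p6 (K : Type*) [Field K] [CharZero K] :
    (∃ H : Subgroup (Matrix.ProjGenLinGroup (Fin 3) K),
        Nonempty (H ≃* Matrix.ProjectiveSpecialLinearGroup (Fin 2) (ZMod 7))) ↔
      ∃ x : K, x ^ 2 = -7 := by
  constructor
  · rintro ⟨H, ⟨e⟩⟩
    let f : SpecialLinearGroup (Fin 2) (ZMod 7) →* ProjGenLinGroup (Fin 3) K :=
      H.subtype.comp (e.symm.toMonoidHom.comp (QuotientGroup.mk' _))
    refine exists_sq_eq_neg_seven (u := f (slUnip 1)) (d := f (slDiag 4 four_ne_zero_zmod_seven)) ?_ ?_ ?_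
    · rw [← map_pow, show slDiag (4 : ZMod 7) four_ne_zero_zmod_seven ^ 3 = 1 by decide +kernel, map_one]
    · rw [← map_inv, ← map_mul, ← map_mul, ← map_pow]
      exact congrArg f (by decide +kernel)
    · intro h
      have h1 : (QuotientGroup.mk (slUnip 1) :
          ProjectiveSpecialLinearGroup (Fin 2) (ZMod 7)) = 1 :=
        e.symm.injective ((Subtype.ext h).trans (map_one e.symm).symm)
      have hz := (QuotientGroup.eq_one_iff _).mp h1
      -- A central `slUnip 1` would commute with `slWeyl`, which it does not.
      have hcomm := Subgroup.mem_center_iff.mp hz slWeyl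
      revert hcomm
      decide +kernel
  · rintro ⟨x, hx⟩
    obtain ⟨Ψ, hΨ⟩ := exists_injective_psl_hom hx
    exact ⟨Ψ.range, ⟨(MonoidHom.ofInjective hΨ).symm⟩⟩
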